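/- Let $\Bbbk$ be an algebraically closed field of characteristic zero, let $h\in\Bbbk[x]$ have degree $N\ge 1$, and let $A_h=\Bbbk[x][t;h\,\partial_x]$ be the $\Bbbk$-algebra generated by $x$ and $t$ subject to $tx=xt+h(x)$. For $r\in\Bbbk[x]$ let $\sigma_r$ be the $\Bbbk$-automorphism of $A_h$ with $\sigma_r(x)=x$ and $\sigma_r(t)=t+r(x)$. For $a\in\Bbbk^*$ with $h(ax)=a^Nh(x)$ let $\tau_a$ be the $\Bbbk$-automorphism of $A_h$ with $\tau_a(x)=ax$ and $\tau_a(t)=a^{N-1}t$. For $w\in A_h$ let $ad_w(u)=wu-uw$. For $s\in\Bbbk[x]$ let $\Delta_s$ be the $\Bbbk$-derivation of $A_h$ with $\Delta_s(x)=0$ and $\Delta_s(t)=s(x)$. For a $\Bbbk$-derivation $D$ of $A_h$ let $\mathrm{Aut}_D(A_h)$ be the group of all $\Bbbk$-automorphisms $\rho$ of $A_h$ with $\rho D=D\rho$. Let $w=\sum_{i=0}^{\ell}w_i(x)t^i\in A_h$ with $w_i\in\Bbbk[x]$, $\ell\ge 2$, $w_\ell\ne 0$ and $w_{\ell-1}=0$.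 Let $s\in\Bbbk[x]$ with $\deg s<N$, and let $D=ad_w+\Delta_s$. (1) If $\rho=\sigma_r\circ\tau_a\in\mathrm{Aut}_D(A_h)$, with $r\in\Bbbk[x]$ and $a\in\Bbbk^*$ such that $h(ax)=a^Nh(x)$, then $r=0$. (2) If moreover the coefficient of $x^{N-1}$ in $h$ is zero, then $$\mathrm{Aut}_D(A_h)=\{\tau_a \mid a\in\Bbbk^*,\ h(ax)=a^Nh(x),\ \tau_a(w)=w,\ s(ax)=a^{N-1}s(x)\}.$$ In particular, if also $s=c\,x^{N-1}$ for some $c\in\Bbbk$ (for example $s=0$), then $\mathrm{Aut}_D(A_h)=\{\tau_a \mid a\in\Bbbk^*,\ h(ax)=a^Nh(x),\ \tau_a(w)=w\}$. -/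

import Mathlib

open Polynomial

noncomputable section

namespace OreAlg

/-! ## Derivations and isotropy groups of a (not necessarily commutative) algebra -/

section General

variable (k : Type*) [CommRing k] (R : Type*) [Ring R] [Algebra k R]

/-- The `k`-module of `k`-derivations of `R`, inside the `k`-linear endomorphisms. -/
def Der : Submodule k (Module.End k R) where
  carrier := {D | ∀ u v : R, D (u * v) = D u * v + u * D v}
  zero_mem' := by intro u v; simp
  add_mem' := by
    intro D E hD hE u v
    simp only [LinearMap.add_apply, hD u v, hE u v, add_mul, mul_add]
    abel
  smul_mem' := by
    intro c D hD u v
    simp only [LinearMap.smul_apply, hD u v, smul_add, smul_mul_assoc, mul_smul_comm]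

/-- The inner derivation `ad_w(u) = w u - u w`. -/
def ad (w : R) : Module.End k R := LinearMap.mulLeft k w - LinearMap.mulRight k w

theorem ad_apply (w u : R) : ad k R w u = w * u - u * w := rfl

theorem ad_mem_der (w : R) : ad k R w ∈ Der k R := by
  intro u v
  simp only [ad_apply, mul_sub, sub_mul, mul_assoc]
  abel

variable {k R}

/-- The isotropy group of a `k`-linear map `D` (in practice a derivation):
the `k`-algebra automorphisms `ρ` with `ρ ∘ D = D ∘ ρ`. -/
def isotropy (D : Module.End k R) : Subgroup (R ≃ₐ[k] R) where
  carrier := {ρ | ∀ u : R, ρ (D u) = D (ρ u)}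
  one_mem' := by intro u; rfl
  mul_mem' := by
    intro ρ θ hρ hθ u
    simp only [AlgEquiv.mul_apply, hθ u, hρ (θ u)]
  inv_mem' := by
    intro ρ hρ u
    apply ρ.injective
    have e : ∀ v : R, ρ (ρ⁻¹ v) = v := fun v => ρ.apply_symm_apply v
    rw [e, hρ, e]

end General

/-! ## The algebra `A_h` -/

variable {k : Type*} [Field k]

/-- The relation `t x = x t + h(x)` on the free algebra on `x = ι 0` and `t = ι 1`. -/
inductive Rel (h : k[X]) : FreeAlgebra k (Fin 2) → FreeAlgebra k (Fin 2) → Prop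
  | comm : Rel h (FreeAlgebra.ι k 1 * FreeAlgebra.ι k 0)
      (FreeAlgebra.ι k 0 * FreeAlgebra.ι k 1 + aeval (FreeAlgebra.ι k 0) h)

/-- `A_h = k[x][t; h ∂ₓ]`: the `k`-algebra generated by `x`, `t` subject to
`t x = x t + h(x)`. -/
def A (h : k[X]) : Type _ := RingQuot (Rel h)

instance (h : k[X]) : Ring (A h) := inferInstanceAs (Ring (RingQuot (Rel h)))

instance (h : k[X]) : Algebra k (A h) := inferInstanceAs (Algebra k (RingQuot (Rel h)))

/-- The quotient map from the free algebra. -/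
def mk (h : k[X]) : FreeAlgebra k (Fin 2) →ₐ[k] A h := RingQuot.mkAlgHom k (Rel h)

/-- The generator `x` of `A_h`. -/
def x (h : k[X]) : A h := mk h (FreeAlgebra.ι k 0)

/-- The generator `t` of `A_h`. -/
def t (h : k[X]) : A h := mk h (FreeAlgebra.ι k 1)

/-- The element `f(x)` of `A_h`. -/
def ofPoly (h f : k[X]) : A h := aeval (x h) f

theorem t_mul_x (h : k[X]) : t h * x h = x h * t h + ofPoly h h := by
  have e : mk h _ = mk h _ := RingQuot.mkAlgHom_rel k (Rel.comm (h := h))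
  rw [map_mul, map_add, map_mul, ← Polynomial.aeval_algHom_apply] at e
  exact e

/-- The universal property of `A_h`. -/
def lift (h : k[X]) {B : Type*} [Ring B] [Algebra k B] (u v : B)
    (huv : v * u = u * v + aeval u h) : A h →ₐ[k] B :=
  RingQuot.liftAlgHom k ⟨FreeAlgebra.lift k ![u, v], by
    rintro _ _ ⟨⟩
    simpa [← Polynomial.aeval_algHom_apply] using huv⟩

section lift

variable (h : k[X]) {B : Type*} [Ring B] [Algebra k B] (u v : B)
    (huv : v * u = u * v + aeval u h)

@[simp] theorem lift_x : lift h u v huv (x h) = u := by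
  have e := RingQuot.liftAlgHom_mkAlgHom_apply k (FreeAlgebra.lift k ![u, v]) (s := Rel h) (by
    rintro _ _ ⟨⟩
    simpa [← Polynomial.aeval_algHom_apply] using huv) (FreeAlgebra.ι k 0)
  exact e.trans (by simp)

@[simp] theorem lift_t : lift h u v huv (t h) = v := by
  have e := RingQuot.liftAlgHom_mkAlgHom_apply k (FreeAlgebra.lift k ![u, v]) (s := Rel h) (by
    rintro _ _ ⟨⟩
    simpa [← Polynomial.aeval_algHom_apply] using huv) (FreeAlgebra.ι k 1)
  exact e.trans (by simp)

@[ext] theorem hom_ext {h : k[X]} {f g : A h →ₐ[k] B} (hx : f (x h) = g (x h))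
    (ht : f (t h) = g (t h)) : f = g := by
  refine RingQuot.ringQuot_ext' k f g ?_
  apply FreeAlgebra.hom_ext
  funext i
  fin_cases i
  · exact hx
  · exact ht

end lift

theorem map_ofPoly {h : k[X]} {B : Type*} [Ring B] [Algebra k B] (f : A h →ₐ[k] B) (p : k[X]) :
    f (ofPoly h p) = aeval (f (x h)) p :=
  (Polynomial.aeval_algHom_apply f (x h) p).symm

theorem commute_x_ofPoly (h p : k[X]) : x h * ofPoly h p = ofPoly h p * x h := by
  have e : ofPoly h (X * p) = ofPoly h (p * X) := by rw [mul_comm]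
  simpa [ofPoly] using e

/-! ## The automorphisms `σ_r` and `τ_a` -/

/-- The endomorphism `x ↦ x`, `t ↦ t + r(x)`. -/
def sigmaHom (h r : k[X]) : A h →ₐ[k] A h :=
  lift h (x h) (t h + ofPoly h r) (by
    rw [add_mul, mul_add, t_mul_x, commute_x_ofPoly, ofPoly]; abel)

/-- The automorphism `σ_r` of `A_h`: `σ_r(x) = x`, `σ_r(t) = t + r(x)`. -/
def sigma (h r : k[X]) : A h ≃ₐ[k] A h :=
  AlgEquiv.ofAlgHom (sigmaHom h r) (sigmaHom h (-r))
    (by ext <;> simp [sigmaHom, map_ofPoly]; simp [ofPoly])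
    (by ext <;> simp [sigmaHom, map_ofPoly]; simp [ofPoly])

/-- The group of all `a ∈ k*` with `h(a x) = a ^ N h(x)`, where `N = deg h`. -/
def scal (h : k[X]) : Subgroup kˣ where
  carrier := {a | h.comp (C (a : k) * X) = C ((a : k) ^ h.natDegree) * h}
  one_mem' := by simp
  mul_mem' := by
    intro a b ha hb
    have e : h.comp (C ((a * b : kˣ) : k) * X) = (h.comp (C (a : k) * X)).comp (C (b : k) * X) := by
      rw [comp_assoc]; simp [mul_assoc]
    simp only [Set.mem_ofPred_eq] at ha hb ⊢
    rw [e, ha, mul_comp, hb, C_comp, ← mul_assoc, ← C_mul, Units.val_mul, mul_pow]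
  inv_mem' := by
    intro a ha
    simp only [Set.mem_ofPred_eq] at ha ⊢
    have e := congrArg (fun p => C ((a⁻¹ : kˣ) : k) ^ h.natDegree * p.comp (C ((a⁻¹ : kˣ) : k) * X)) ha
    simp only [comp_assoc, mul_comp, C_comp, X_comp] at e
    rw [← mul_assoc, ← mul_assoc, ← C_mul, ← C_pow, ← C_mul, ← mul_pow] at e
    simpa using e.symm

/-- The endomorphism `x ↦ a x`, `t ↦ a ^ (N - 1) t`, where `N = deg h`. -/
def tauHom (h : k[X]) (a : scal h) : A h →ₐ[k] A h :=
  lift h (((a : kˣ) : k) • x h) (((a : kˣ) : k) ^ ((h.natDegree : ℤ) - 1) • t h) (by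
    have e : aeval (((a : kˣ) : k) • x h) h = ((a : kˣ) : k) ^ h.natDegree • ofPoly h h := by
      have e' := congrArg (aeval (x h)) a.2
      rw [aeval_comp] at e'
      simpa [ofPoly, Algebra.smul_def] using e'
    have e2 : ((a : kˣ) : k) * ((a : kˣ) : k) ^ ((h.natDegree : ℤ) - 1)
        = ((a : kˣ) : k) ^ h.natDegree := by
      rw [← zpow_one_add₀ (Units.ne_zero _)]; simp
    rw [e, smul_mul_smul_comm, smul_mul_smul_comm, e2, mul_comm, e2, t_mul_x, smul_add])

/-- The automorphism `τ_a` of `A_h`: `τ_a(x) = a x`, `τ_a(t) = a ^ (N - 1) t`, for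
`a ∈ k*` with `h(a x) = a ^ N h(x)`, where `N = deg h`. -/
def tau (h : k[X]) (a : scal h) : A h ≃ₐ[k] A h :=
  AlgEquiv.ofAlgHom (tauHom h a) (tauHom h a⁻¹)
    (by ext <;> simp [tauHom, smul_smul, ← zpow_add₀])
    (by ext <;> simp [tauHom, smul_smul, ← zpow_add₀])

/-! ## The derivations `Δ_s` -/

/-- The homomorphism `u ↦ u + ε Δ_s(u)` to the dual numbers over `A_h`, determined by
`x ↦ x`, `t ↦ t + ε s(x)`. -/
def deltaHom (h s : k[X]) : A h →ₐ[k] TrivSqZeroExt (A h) (A h) :=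
  lift h (TrivSqZeroExt.inl (x h)) (TrivSqZeroExt.inl (t h) + TrivSqZeroExt.inr (ofPoly h s)) (by
    have e : aeval (TrivSqZeroExt.inl (x h) : TrivSqZeroExt (A h) (A h)) h
        = TrivSqZeroExt.inl (ofPoly h h) :=
      Polynomial.aeval_algHom_apply (TrivSqZeroExt.inlAlgHom k (A h) (A h)) (x h) h
    rw [e]
    ext
    · simp [t_mul_x]
    · simp [commute_x_ofPoly])

/-- The derivation `Δ_s` of `A_h`: `Δ_s(x) = 0`, `Δ_s(t) = s(x)`. -/
def delta (h s : k[X]) : Module.End k (A h) :=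
  (TrivSqZeroExt.sndHom (A h) (A h)).restrictScalars k ∘ₗ (deltaHom h s).toLinearMap

theorem fst_deltaHom (h s : k[X]) (u : A h) : (deltaHom h s u).fst = u := by
  have e : (TrivSqZeroExt.fstHom k (A h) (A h)).comp (deltaHom h s) = AlgHom.id k (A h) := by
    ext <;> simp [deltaHom]
  exact DFunLike.congr_fun e u

theorem delta_x (h s : k[X]) : delta h s (x h) = 0 := by simp [delta, deltaHom]

theorem delta_t (h s : k[X]) : delta h s (t h) = ofPoly h s := by simp [delta, deltaHom]

theorem delta_mem_der (h s : k[X]) : delta h s ∈ Der k (A h) := by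
  intro u v
  simp [delta, fst_deltaHom, add_comm]

theorem sigma_x (h r : k[X]) : sigma h r (x h) = x h := by simp [sigma, sigmaHom]

theorem sigma_t (h r : k[X]) : sigma h r (t h) = t h + ofPoly h r := by simp [sigma, sigmaHom]

theorem tau_x (h : k[X]) (a : scal h) : tau h a (x h) = ((a : kˣ) : k) • x h := by
  simp [tau, tauHom]

theorem tau_t (h : k[X]) (a : scal h) :
    tau h a (t h) = ((a : kˣ) : k) ^ ((h.natDegree : ℤ) - 1) • t h := by
  simp [tau, tauHom]

end OreAlg

end

/-!
The algebra `A_h` acts on `k[x][Y]`, with `x` acting by multiplication and `t` by `Y + h ∂ₓ`.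
Since `∂ₓ` kills `1`, the element `∑ pᵢ(x) tⁱ` sends `1` to `∑ pᵢ Yⁱ`; hence the map
`symb : u ↦ u • 1` is a linear isomorphism `A_h ≃ k[x][Y]` (`symb_ofSymb`, `ofSymb_symb`), so
every element has a unique normal form. The degree in `t`, i.e. the `Y`-degree of `symb`, is
additive on products (`natDegree_symb_mul`), so `A_h` is a domain whose units are the scalars.
In characteristic zero the centralizer of `x` is `k[x]` (`eq_ofPoly_of_commute_x`).

Automorphisms. All commutators lie in `h A_h` (`exists_commutator_eq`), and `h = t x - x t` is one.
So an automorphism `ρ` maps `h A_h` onto itself and `ρ h = c h` for a scalar `c`. Then `h(ρ x)` has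
degree `0` in `t`, which forces `ρ x ∈ k[x]`; the same holds for `ρ⁻¹`, so `ρ x = a x + b`.
Comparing coefficients in `h(a x + b) = c h(x)` gives `c = a ^ N`, and `b = 0` when the second
coefficient of `h` vanishes. Finally `ρ t - a ^ (N - 1) t` commutes with `x`, so it lies in `k[x]`:
`ρ = σ_r τ_a` (`exists_eq_sigma_mul_tau`).

Isotropy. Let `ρ = σ_r τ_a` commute with `D = ad_W + Δ_s`. Evaluating at `x` shows that
`ρ W - W` commutes with `x`, so `ρ W = W + g(x)`. As `ℓ - 1 ≥ 1`, the coefficient of `t ^ (ℓ - 1)`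
must agree on both sides; it is `0` on the right and a nonzero scalar times `ℓ w_ℓ(a x) r` on the
left, so `r = 0` (`eq_zero_of_sigma_mul_tau_mem_isotropy`). Evaluating at `t` then gives
`s(a x) - a ^ (N - 1) s = a ^ (N - 1) h g'`. The left side has degree less than `N`, so `g' = 0` and
`s(a x) = a ^ (N - 1) s`. The scalar `g` is zero because the coefficients of `t ^ 0` in `τ_a W` and
`W` are `w_0(a x)` and `w_0(x)`, which agree at `x = 0` (`tau_mem_isotropy_iff`).
-/

namespace OreAlg

/-! ### Normal forms in `A_h` -/

section Basis

variable {k : Type*} [Field k]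

/-- Coefficientwise derivative `∂ₓ` on `k[x][Y]`. -/
noncomputable def coeffDeriv : k[X][X] →ₗ[k] k[X][X] :=
  Polynomial.lsum fun n => (monomial n).restrictScalars k ∘ₗ derivative

theorem coeff_coeffDeriv (q : k[X][X]) (n : ℕ) :
    (coeffDeriv q).coeff n = derivative (q.coeff n) := by
  simp only [coeffDeriv, lsum_apply, LinearMap.comp_apply, LinearMap.restrictScalars_apply,
    sum_def, finsetSum_coeff, coeff_monomial]
  rw [Finset.sum_ite_eq']
  split_ifs with hn
  · rfl
  · rw [notMem_support_iff.1 hn, derivative_zero]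

/-- The operator `Y + h ∂ₓ` on `k[x][Y]`, by which `t` acts. -/
noncomputable def tOp (h : k[X]) : Module.End k k[X][X] :=
  LinearMap.mulLeft k X + LinearMap.mulLeft k (C h) ∘ₗ coeffDeriv

theorem tOp_apply (h : k[X]) (q : k[X][X]) : tOp h q = X * q + C h * coeffDeriv q := rfl

theorem coeff_tOp_zero (h : k[X]) (q : k[X][X]) :
    (tOp h q).coeff 0 = h * derivative (q.coeff 0) := by
  simp [tOp_apply, coeff_coeffDeriv]

theorem coeff_tOp_succ (h : k[X]) (q : k[X][X]) (n : ℕ) :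
    (tOp h q).coeff (n + 1) = q.coeff n + h * derivative (q.coeff (n + 1)) := by
  simp [tOp_apply, coeff_coeffDeriv]

theorem tOp_C_mul (h p : k[X]) (q : k[X][X]) :
    tOp h (C p * q) = C p * tOp h q + C (h * derivative p) * q := by
  ext1 n
  cases n with
  | zero => simp [coeff_tOp_zero]; ring
  | succ n =>
    simp only [coeff_tOp_succ, coeff_C_mul, coeff_add, derivative_mul]
    ring

/-- The action of `A_h` on `k[x][Y]` in which `x` acts by multiplication and `t` acts by
`Y + h ∂ₓ`. -/
noncomputable def act (h : k[X]) : A h →ₐ[k] Module.End k k[X][X] :=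
  lift h (LinearMap.mulLeft k (C X)) (tOp h) (by
    have e : aeval (LinearMap.mulLeft k (C X : k[X][X])) h = LinearMap.mulLeft k (C h) := by
      have e1 := Polynomial.aeval_algHom_apply (Algebra.lmul k k[X][X]) (C X) h
      have e2 : aeval (C X : k[X][X]) h = C h := by
        have := Polynomial.aeval_algHom_apply (CAlgHom : k[X] →ₐ[k] k[X][X]) X h
        simpa using this
      rw [e2] at e1
      exact e1
    rw [e]
    refine LinearMap.ext fun q => ?_
    simp [tOp_C_mul])

theorem act_x (h : k[X]) (q : k[X][X]) : act h (x h) q = C X * q := by simp [act]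

theorem act_t (h : k[X]) (q : k[X][X]) : act h (t h) q = tOp h q := by simp [act]

theorem act_ofPoly (h p : k[X]) (q : k[X][X]) : act h (ofPoly h p) q = C p * q := by
  induction p using Polynomial.induction_on' generalizing q with
  | add p r hp hr => simp_all [ofPoly, add_mul]
  | monomial n a =>
    induction n generalizing q with
    | zero =>
      rw [ofPoly, aeval_monomial]
      simp [Algebra.smul_def]
    | succ n ih =>
      have e : ofPoly h (monomial (n + 1) a) = ofPoly h (monomial n a) * x h := by
        simp [ofPoly, aeval_monomial, pow_succ, mul_assoc]
      rw [e, map_mul, Module.End.mul_apply, act_x, ih, ← mul_assoc, ← C_mul, monomial_mul_X]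

/-- The normal form of an element of `A_h`: `∑ pᵢ(x) tⁱ ↦ ∑ pᵢ Yⁱ`, obtained by
letting the element act on `1`. -/
noncomputable def symb (h : k[X]) : A h →ₗ[k] k[X][X] := LinearMap.applyₗ 1 ∘ₗ (act h).toLinearMap

theorem symb_apply (h : k[X]) (u : A h) : symb h u = act h u 1 := rfl

theorem symb_mul (h : k[X]) (u v : A h) : symb h (u * v) = act h u (symb h v) := by
  simp [symb_apply]

theorem symb_one (h : k[X]) : symb h 1 = 1 := by simp [symb_apply]

theorem symb_ofPoly (h p : k[X]) : symb h (ofPoly h p) = C p := by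
  rw [symb_apply, act_ofPoly, mul_one]

theorem symb_ofPoly_mul (h p : k[X]) (u : A h) :
    symb h (ofPoly h p * u) = C p * symb h u := by
  rw [symb_mul, act_ofPoly]

theorem symb_t_mul (h : k[X]) (u : A h) : symb h (t h * u) = tOp h (symb h u) := by
  rw [symb_mul, act_t]

theorem symb_t_pow (h : k[X]) (n : ℕ) : symb h (t h ^ n) = X ^ n := by
  induction n with
  | zero => simp [symb_one]
  | succ n ih =>
    have e : coeffDeriv (X ^ n : k[X][X]) = 0 := by
      ext1 m
      rw [coeff_coeffDeriv, coeff_X_pow]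
      split_ifs <;> simp
    rw [pow_succ', symb_t_mul, ih, tOp_apply, e, mul_zero, add_zero, pow_succ']

/-- The element `∑ pᵢ(x) tⁱ` of `A_h`, for `∑ pᵢ Yⁱ` in `k[x][Y]`. -/
noncomputable def ofSymb (h : k[X]) : k[X][X] →ₗ[k] A h :=
  Polynomial.lsum fun n => LinearMap.mulRight k (t h ^ n) ∘ₗ (aeval (x h)).toLinearMap

theorem ofSymb_monomial (h p : k[X]) (n : ℕ) :
    ofSymb h (monomial n p) = ofPoly h p * t h ^ n := by
  simp [ofSymb, lsum_apply, ofPoly]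

theorem symb_ofSymb (h : k[X]) (q : k[X][X]) : symb h (ofSymb h q) = q := by
  induction q using Polynomial.induction_on' with
  | add p r hp hr => rw [map_add, map_add, hp, hr]
  | monomial n a =>
    rw [ofSymb_monomial, symb_ofPoly_mul, symb_t_pow, C_mul_X_pow_eq_monomial]

/-- A subalgebra of `A_h` containing `x` and `t` is everything. -/
theorem induction {h : k[X]} {P : A h → Prop} (hs : ∀ c : k, P (algebraMap k (A h) c))
    (hx : P (x h)) (ht : P (t h)) (hadd : ∀ u v, P u → P v → P (u + v))
    (hmul : ∀ u v, P u → P v → P (u * v)) (u : A h) : P u := by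
  obtain ⟨u, rfl⟩ := RingQuot.mkAlgHom_surjective k (Rel h) u
  change P (mk h u)
  induction u using FreeAlgebra.induction with
  | grade0 r => rw [AlgHom.commutes]; exact hs r
  | grade1 i => fin_cases i; exacts [hx, ht]
  | mul a b ha hb => rw [map_mul]; exact hmul _ _ ha hb
  | add a b ha hb => rw [map_add]; exact hadd _ _ ha hb

theorem ofPoly_mul (h p q : k[X]) : ofPoly h (p * q) = ofPoly h p * ofPoly h q := by simp [ofPoly]

theorem t_mul_ofPoly (h p : k[X]) :
    t h * ofPoly h p = ofPoly h p * t h + ofPoly h (h * derivative p) := by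
  induction p using Polynomial.induction_on' with
  | add p r hp hr =>
    simp only [ofPoly, map_add, mul_add, add_mul] at hp hr ⊢
    rw [hp, hr]; abel
  | monomial n a =>
    induction n with
    | zero => simp [ofPoly, Algebra.commutes]
    | succ n ih =>
      have e : (monomial (n + 1) a : k[X]) = monomial n a * X := (monomial_mul_X n a).symm
      have ex : ofPoly h X = x h := by simp [ofPoly]
      rw [e, derivative_mul, derivative_X, mul_one, ofPoly_mul, ← mul_assoc, ih, add_mul,
        mul_assoc, ex, t_mul_x, mul_add, add_assoc, ← mul_assoc]
      congr 1
      rw [mul_add, ofPoly, ofPoly, ofPoly, ofPoly, map_add, mul_comm h (monomial n a)]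
      simp [mul_assoc, add_comm]

theorem ofSymb_act (h : k[X]) (u : A h) (q : k[X][X]) :
    ofSymb h (act h u q) = u * ofSymb h q := by
  induction u using OreAlg.induction generalizing q with
  | hs c => simp [Algebra.algebraMap_eq_smul_one]
  | hx =>
    rw [act_x]
    induction q using Polynomial.induction_on' with
    | add p r hp hr => rw [mul_add, map_add, map_add, hp, hr, mul_add]
    | monomial n a =>
      rw [C_mul_monomial, ofSymb_monomial, ofSymb_monomial, ofPoly_mul]
      simp [ofPoly, mul_assoc]
  | ht =>
    rw [act_t]
    induction q using Polynomial.induction_on' with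
    | add p r hp hr => rw [map_add, map_add, map_add, hp, hr, mul_add]
    | monomial n a =>
      have e : tOp h (monomial n a) = monomial (n + 1) a + monomial n (h * derivative a) := by
        have e0 : coeffDeriv (monomial n a) = monomial n (derivative a) := by
          ext1 m
          rw [coeff_coeffDeriv, coeff_monomial, coeff_monomial]
          split_ifs <;> simp
        rw [tOp_apply, e0, X_mul_monomial, C_mul_monomial]
      rw [e, map_add, ofSymb_monomial, ofSymb_monomial, ofSymb_monomial, ← mul_assoc,
        t_mul_ofPoly, add_mul, mul_assoc _ (t h), pow_succ']
  | hadd u v hu hv => simp [hu, hv, add_mul]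
  | hmul u v hu hv => simp [hu, hv, mul_assoc]

theorem ofSymb_symb (h : k[X]) (u : A h) : ofSymb h (symb h u) = u := by
  have e : ofSymb h 1 = 1 := by
    have := ofSymb_monomial h 1 0
    simpa [ofPoly] using this
  rw [symb_apply, ofSymb_act, e, mul_one]

theorem symb_injective (h : k[X]) : Function.Injective (symb h) :=
  Function.LeftInverse.injective (ofSymb_symb h)

theorem ofPoly_injective (h : k[X]) : Function.Injective (ofPoly h) := fun p q e => by
  have := congrArg (symb h) e
  rwa [symb_ofPoly, symb_ofPoly, C_inj] at this

theorem eq_sum (h : k[X]) (u : A h) {n : ℕ} (hn : (symb h u).natDegree ≤ n) :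
    u = ∑ i ∈ Finset.range (n + 1), ofPoly h ((symb h u).coeff i) * t h ^ i := by
  conv_lhs => rw [← ofSymb_symb h u, (symb h u).as_sum_range' (n + 1) (by omega), map_sum]
  simp only [ofSymb_monomial]

end Basis

/-! ### The degree in `t`, the centralizer of `x`, and commutators -/

section Degree

variable {k : Type*} [Field k]

theorem natDegree_tOp_le (h : k[X]) {q : k[X][X]} {n : ℕ} (hq : q.natDegree ≤ n) :
    (tOp h q).natDegree ≤ n + 1 := by
  rw [natDegree_le_iff_coeff_eq_zero] at hq ⊢
  intro m hm
  obtain ⟨m, rfl⟩ : ∃ j, m = j + 1 := ⟨m - 1, by omega⟩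
  rw [coeff_tOp_succ, hq m (by omega), hq (m + 1) (by omega)]
  simp

theorem coeff_tOp_top (h : k[X]) {q : k[X][X]} {n : ℕ} (hq : q.natDegree ≤ n) :
    (tOp h q).coeff (n + 1) = q.coeff n := by
  rw [coeff_tOp_succ, coeff_eq_zero_of_natDegree_lt (by omega : q.natDegree < n + 1)]
  simp

theorem natDegree_tOp_pow_le (h : k[X]) {q : k[X][X]} {n : ℕ} (hq : q.natDegree ≤ n) (i : ℕ) :
    ((tOp h ^ i) q).natDegree ≤ i + n := by
  induction i with
  | zero => simpa using hq
  | succ i ih =>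
    rw [pow_succ', Module.End.mul_apply]
    exact (natDegree_tOp_le h ih).trans (by omega)

theorem coeff_tOp_pow_top (h : k[X]) {q : k[X][X]} {n : ℕ} (hq : q.natDegree ≤ n) (i : ℕ) :
    ((tOp h ^ i) q).coeff (i + n) = q.coeff n := by
  induction i with
  | zero => simp
  | succ i ih =>
    rw [pow_succ', Module.End.mul_apply, show i + 1 + n = i + n + 1 by omega,
      coeff_tOp_top h (natDegree_tOp_pow_le h hq i), ih]

theorem symb_mul_eq_sum (h : k[X]) (u v : A h) {n : ℕ} (hn : (symb h u).natDegree ≤ n) :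
    symb h (u * v) =
      ∑ i ∈ Finset.range (n + 1), C ((symb h u).coeff i) * (tOp h ^ i) (symb h v) := by
  conv_lhs => rw [eq_sum h u hn, symb_mul, map_sum, LinearMap.sum_apply]
  refine Finset.sum_congr rfl fun i _ => ?_
  rw [map_mul, Module.End.mul_apply, act_ofPoly, map_pow]
  congr 2
  exact congrArg (· ^ i) (LinearMap.ext (act_t h))

theorem natDegree_symb_mul_le (h : k[X]) (u v : A h) :
    (symb h (u * v)).natDegree ≤ (symb h u).natDegree + (symb h v).natDegree := by
  rw [symb_mul_eq_sum h u v le_rfl]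
  refine natDegree_sum_le_of_forall_le _ _ fun i hi => ?_
  refine (natDegree_C_mul_le _ _).trans ((natDegree_tOp_pow_le h le_rfl i).trans ?_)
  have := Finset.mem_range.1 hi
  omega

theorem coeff_symb_mul_top (h : k[X]) (u v : A h) :
    (symb h (u * v)).coeff ((symb h u).natDegree + (symb h v).natDegree) =
      (symb h u).leadingCoeff * (symb h v).leadingCoeff := by
  rw [symb_mul_eq_sum h u v le_rfl, finsetSum_coeff, Finset.sum_range_succ, Finset.sum_eq_zero,
    zero_add, coeff_C_mul, coeff_tOp_pow_top h le_rfl]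
  · rfl
  intro i hi
  rw [coeff_C_mul, coeff_eq_zero_of_natDegree_lt (p := (tOp h ^ i) _), mul_zero]
  have := Finset.mem_range.1 hi
  have := natDegree_tOp_pow_le h (le_refl (symb h v).natDegree) i
  omega

theorem symb_eq_zero_iff {h : k[X]} {u : A h} : symb h u = 0 ↔ u = 0 :=
  map_eq_zero_iff _ (symb_injective h)

theorem coeff_symb_mul_top_ne_zero {h : k[X]} {u v : A h} (hu : u ≠ 0) (hv : v ≠ 0) :
    (symb h (u * v)).coeff ((symb h u).natDegree + (symb h v).natDegree) ≠ 0 := by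
  rw [coeff_symb_mul_top]
  exact mul_ne_zero (leadingCoeff_ne_zero.2 (symb_eq_zero_iff.not.2 hu))
    (leadingCoeff_ne_zero.2 (symb_eq_zero_iff.not.2 hv))

/-- The degree in `t` is additive on products. -/
theorem natDegree_symb_mul {h : k[X]} {u v : A h} (hu : u ≠ 0) (hv : v ≠ 0) :
    (symb h (u * v)).natDegree = (symb h u).natDegree + (symb h v).natDegree :=
  le_antisymm (natDegree_symb_mul_le h u v)
    (le_natDegree_of_ne_zero (coeff_symb_mul_top_ne_zero hu hv))

instance (h : k[X]) : Nontrivial (A h) :=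
  ⟨0, 1, fun e => by simpa [symb_one] using congrArg (symb h) e⟩

instance (h : k[X]) : NoZeroDivisors (A h) where
  eq_zero_or_eq_zero_of_mul_eq_zero {u v} e := by
    by_contra! H
    exact coeff_symb_mul_top_ne_zero H.1 H.2 (by simp [e])

instance (h : k[X]) : IsDomain (A h) := NoZeroDivisors.to_isDomain _

theorem eq_ofPoly_of_natDegree_symb {h : k[X]} {u : A h} (hu : (symb h u).natDegree = 0) :
    u = ofPoly h ((symb h u).coeff 0) := by
  simpa using eq_sum h u hu.le

/-- Substituting an element of positive degree in `t` into a polynomial multiplies degrees. -/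
theorem natDegree_symb_aeval {h : k[X]} {u : A h} (hu : 0 < (symb h u).natDegree) (p : k[X]) :
    (symb h (aeval u p)).natDegree = p.natDegree * (symb h u).natDegree := by
  have hu0 : u ≠ 0 := by rintro rfl; simp at hu
  have hC : ∀ c : k, symb h (algebraMap k (A h) c) = C (C c) := fun c => by
    rw [← symb_ofPoly, ofPoly, aeval_C]
  induction hn : p.natDegree generalizing p with
  | zero =>
    rw [eq_C_of_natDegree_eq_zero hn]
    simp [hC]
  | succ n ih =>
    have hd : p.divX.natDegree = n := by rw [natDegree_divX_eq_natDegree_tsub_one, hn]; rfl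
    have ih := ih p.divX hd
    by_cases h0 : aeval u p.divX = 0
    · -- If `u` were a root of `p.divX`, induction would make `p.divX` a constant, hence zero.
      exfalso
      rw [h0] at ih
      have hn0 : n = 0 := by
        rw [map_zero, natDegree_zero, eq_comm, mul_eq_zero] at ih
        omega
      subst hn0
      rw [eq_C_of_natDegree_eq_zero hd, aeval_C, map_eq_zero] at h0
      have : p.natDegree = 0 := by
        rw [← divX_mul_X_add p, eq_C_of_natDegree_eq_zero hd, h0]; simp
      omega
    · conv_lhs => rw [← divX_mul_X_add p]
      rw [map_add, map_mul, aeval_X, aeval_C, map_add, hC]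
      rw [natDegree_add_C, natDegree_symb_mul h0 hu0, ih]
      ring

/-- `x` commutes with no element of positive degree: the centralizer of `x` is `k[x]`. -/
theorem eq_ofPoly_of_commute_x [CharZero k] {h : k[X]} (hh : h ≠ 0) {u : A h}
    (hu : u * x h = x h * u) : ∃ p, u = ofPoly h p := by
  refine ⟨_, eq_ofPoly_of_natDegree_symb ?_⟩
  by_contra hd
  obtain ⟨d, hd⟩ := Nat.exists_eq_succ_of_ne_zero hd
  have hx : ofPoly h X = x h := by simp [ofPoly]
  -- `tⁱ x = x tⁱ + i h tⁱ⁻¹ + ⋯`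
  have key : ∀ i, ((tOp h ^ (i + 1)) (C X)).natDegree ≤ i + 1 ∧
      ((tOp h ^ (i + 1)) (C X)).coeff i = (i + 1 : k[X]) * h := by
    intro i
    refine ⟨natDegree_tOp_pow_le h (natDegree_C _).le (i + 1), ?_⟩
    induction i with
    | zero => simp [coeff_tOp_zero]
    | succ i ih =>
      rw [pow_succ', Module.End.mul_apply, coeff_tOp_succ, ih]
      have := coeff_tOp_pow_top h (natDegree_C (X : k[X])).le (i + 1)
      rw [add_zero] at this
      rw [this]
      simp
      ring
  have e := congrArg (fun v => (symb h v).coeff d) hu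
  rw [symb_mul_eq_sum h u (x h) hd.le, ← hx, symb_ofPoly_mul, symb_ofPoly, finsetSum_coeff,
    Finset.sum_range_succ, Finset.sum_range_succ, Finset.sum_eq_zero, coeff_C_mul, coeff_C_mul,
    coeff_C_mul, (key d).2] at e
  · have := coeff_tOp_pow_top h (natDegree_C (X : k[X])).le d
    rw [add_zero] at this
    rw [this, coeff_C_zero, zero_add, mul_comm, add_eq_left, mul_eq_zero, mul_eq_zero] at e
    rcases e with e | e | e
    · have : (symb h u).leadingCoeff = 0 := by rw [leadingCoeff, hd]; exact e
      rw [leadingCoeff_eq_zero] at this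
      simp [this] at hd
    · exact Nat.cast_add_one_ne_zero (R := k[X]) d e
    · exact hh e
  · intro i hi
    have := Finset.mem_range.1 hi
    rw [coeff_C_mul, coeff_eq_zero_of_natDegree_lt (p := (tOp h ^ i) _), mul_zero]
    exact (natDegree_tOp_pow_le h (natDegree_C _).le i).trans_lt (by omega)

/-- `symb` is multiplicative modulo `h`: `A_h / h A_h` is the commutative ring `(k[x]/h)[Y]`. -/
theorem C_dvd_symb_mul_sub (h : k[X]) (u v : A h) :
    C h ∣ symb h (u * v) - symb h u * symb h v := by
  induction u using OreAlg.induction generalizing v with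
  | hs c =>
    have : algebraMap k (A h) c = ofPoly h (C c) := by simp [ofPoly]
    simp [this, symb_ofPoly_mul, symb_ofPoly]
  | hx =>
    have hx : x h = ofPoly h X := by simp [ofPoly]
    simp [hx, symb_ofPoly_mul, symb_ofPoly]
  | ht =>
    have := symb_t_pow h 1
    rw [pow_one, pow_one] at this
    rw [symb_t_mul, this, tOp_apply, add_sub_cancel_left]
    exact dvd_mul_right _ _
  | hadd u u' hu hu' =>
    have := dvd_add (hu v) (hu' v)
    rw [add_mul, map_add, map_add]
    convert this using 1
    ring
  | hmul u u' hu hu' =>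
    have e := dvd_sub (dvd_add (hu (u' * v)) ((hu' v).mul_left (symb h u)))
      ((hu u').mul_right (symb h v))
    rw [mul_assoc]
    convert e using 1
    ring

theorem exists_commutator_eq (h : k[X]) (u v : A h) : ∃ z, u * v - v * u = ofPoly h h * z := by
  have e := dvd_sub (C_dvd_symb_mul_sub h u v) (C_dvd_symb_mul_sub h v u)
  obtain ⟨q, hq⟩ := e
  refine ⟨ofSymb h q, symb_injective h ?_⟩
  rw [symb_ofPoly_mul, symb_ofSymb, ← hq, map_sub]
  ring

end Degree

/-! ### Automorphisms of `A_h` -/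

section Automorphisms

variable {k : Type*} [Field k]

theorem exists_eq_C_of_mul_eq_one {h : k[X]} {u v : A h} (huv : u * v = 1) :
    ∃ c : k, c ≠ 0 ∧ u = ofPoly h (C c) := by
  have hu : u ≠ 0 := left_ne_zero_of_mul_eq_one huv
  have hv : v ≠ 0 := right_ne_zero_of_mul_eq_one huv
  have hd := natDegree_symb_mul hu hv
  rw [huv, symb_one, natDegree_one] at hd
  have eu := eq_ofPoly_of_natDegree_symb (u := u) (by omega)
  have ev := eq_ofPoly_of_natDegree_symb (u := v) (by omega)
  have h1 : ofPoly h 1 = 1 := by simp [ofPoly]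
  rw [eu, ev, ← ofPoly_mul, ← h1] at huv
  obtain ⟨c, hc, e⟩ := Polynomial.isUnit_iff.1 (.of_mul_eq_one _ (ofPoly_injective h huv))
  exact ⟨c, hc.ne_zero, by rw [eu, e]⟩

theorem ofPoly_ne_zero {h p : k[X]} (hp : p ≠ 0) : ofPoly h p ≠ 0 := fun e =>
  hp (ofPoly_injective h (by rw [e]; simp [ofPoly]))

/-- The ideal `h A_h` is generated by the commutators, hence stable under automorphisms;
its generator `h` is determined up to a scalar because the units of `A_h` are the scalars. -/
theorem exists_apply_ofPoly_self {h : k[X]} (hh : h ≠ 0) (ρ : A h ≃ₐ[k] A h) :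
    ∃ c : k, c ≠ 0 ∧ ρ (ofPoly h h) = ofPoly h h * ofPoly h (C c) := by
  have key : ∀ ρ : A h ≃ₐ[k] A h, ∃ z, ρ (ofPoly h h) = ofPoly h h * z := fun ρ => by
    obtain ⟨z, hz⟩ := exists_commutator_eq h (ρ (t h)) (ρ (x h))
    refine ⟨z, ?_⟩
    rw [← hz, ← map_mul, ← map_mul, ← map_sub, t_mul_x, add_sub_cancel_left]
  obtain ⟨u, hu⟩ := key ρ
  obtain ⟨v, hv⟩ := key ρ.symm
  have e : u * ρ v = 1 := by
    have := congrArg ρ hv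
    rw [AlgEquiv.apply_symm_apply, map_mul, hu, mul_assoc] at this
    exact (mul_eq_left₀ (ofPoly_ne_zero hh)).1 this.symm
  obtain ⟨c, hc, rfl⟩ := exists_eq_C_of_mul_eq_one e
  exact ⟨c, hc, hu⟩

theorem apply_x_eq_ofPoly {h : k[X]} (hh : 1 ≤ h.natDegree) (ρ : A h ≃ₐ[k] A h) :
    ∃ f, ρ (x h) = ofPoly h f := by
  have h0 : h ≠ 0 := by rintro rfl; simp at hh
  obtain ⟨c, -, e⟩ := exists_apply_ofPoly_self h0 ρ
  refine ⟨_, eq_ofPoly_of_natDegree_symb ?_⟩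
  by_contra hd
  have := natDegree_symb_aeval (Nat.pos_of_ne_zero hd) h
  have e' : ρ (ofPoly h h) = aeval (ρ (x h)) h := map_ofPoly ρ.toAlgHom h
  rw [← e', e, ← ofPoly_mul, symb_ofPoly, natDegree_C, eq_comm, mul_eq_zero] at this
  omega

theorem aeval_ofPoly (h f p : k[X]) : aeval (ofPoly h f) p = ofPoly h (p.comp f) := by
  rw [ofPoly, ofPoly, aeval_comp]

theorem apply_x_eq_linear {h : k[X]} (hh : 1 ≤ h.natDegree) (ρ : A h ≃ₐ[k] A h) :
    ∃ a b : k, a ≠ 0 ∧ ρ (x h) = ofPoly h (C a * X + C b) := by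
  obtain ⟨f, hf⟩ := apply_x_eq_ofPoly hh ρ
  obtain ⟨g, hg⟩ := apply_x_eq_ofPoly hh ρ.symm
  have e : g.comp f = X := by
    apply ofPoly_injective h
    have e' : ρ (ofPoly h g) = aeval (ρ (x h)) g := map_ofPoly ρ.toAlgHom g
    rw [← aeval_ofPoly, ← hf, ← e', ← hg, AlgEquiv.apply_symm_apply]
    simp [ofPoly]
  have hd := congrArg natDegree e
  rw [natDegree_comp, natDegree_X] at hd
  have hf1 : f.natDegree = 1 := Nat.eq_one_of_mul_eq_one_left hd
  refine ⟨f.coeff 1, f.coeff 0, ?_, ?_⟩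
  · rw [← hf1]
    exact leadingCoeff_ne_zero.2 (by rintro rfl; simp at hf1)
  · rw [hf, ← eq_X_add_C_of_natDegree_le_one hf1.le]

/-- If the second coefficient of `h` vanishes, an affine substitution that rescales `h` is
a dilation. -/
theorem affine_comp_eq {h : k[X]} [CharZero k] (hh : 1 ≤ h.natDegree)
    (hc : h.coeff (h.natDegree - 1) = 0) {a b c : k} (ha : a ≠ 0)
    (e : h.comp (C a * X + C b) = h * C c) : b = 0 ∧ c = a ^ h.natDegree := by
  obtain ⟨n, hn⟩ : ∃ n, h.natDegree = n + 1 := ⟨h.natDegree - 1, by omega⟩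
  have hl : h.coeff (n + 1) ≠ 0 := by
    rw [← hn]
    exact leadingCoeff_ne_zero.2 (by rintro rfl; simp at hh)
  have e1 : h.comp (C a * X + C b) = (taylor b h).comp (C a * X) := by
    rw [taylor_apply, comp_assoc]; simp
  rw [e1] at e
  have coeffs : ∀ m, (taylor b h).coeff m * a ^ m = h.coeff m * c := fun m => by
    have := congrArg (fun p : k[X] => p.coeff m) e
    simpa [comp_C_mul_X_coeff] using this
  have c1 : (taylor b h).coeff (n + 1) = h.coeff (n + 1) := by
    rw [← hn]; exact coeff_taylor_natDegree _ _
  have c0 : (taylor b h).coeff n = (n + 1 : k) * h.coeff (n + 1) * b := by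
    rw [taylor_coeff]
    have hH : hasseDeriv n h = C ((n + 1 : k) * h.coeff (n + 1)) * X + C (h.coeff n) := by
      ext1 m
      rw [hasseDeriv_coeff]
      rcases m with _ | _ | m
      · simp
      · simp [add_comm 1 n]
      · rw [coeff_eq_zero_of_natDegree_lt (by omega)]
        simp [coeff_one]
    rw [hn, Nat.add_sub_cancel] at hc
    rw [hH, hc]
    simp
  constructor
  · have := coeffs n
    rw [hn, Nat.add_sub_cancel] at hc
    rw [c0, hc, zero_mul] at this
    have hn0 := Nat.cast_add_one_ne_zero (R := k) n
    simpa [ha, hl, hn0] using this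
  · have := coeffs (n + 1)
    rw [c1] at this
    rw [hn]
    exact (mul_left_cancel₀ hl this).symm

theorem sigma_mul_tau_x (h r : k[X]) (a : scal h) :
    (sigma h r * tau h a) (x h) = ((a : kˣ) : k) • x h := by
  rw [AlgEquiv.mul_apply, tau_x, map_smul, sigma_x]

theorem sigma_mul_tau_t (h r : k[X]) (a : scal h) :
    (sigma h r * tau h a) (t h) =
      ((a : kˣ) : k) ^ ((h.natDegree : ℤ) - 1) • (t h + ofPoly h r) := by
  rw [AlgEquiv.mul_apply, tau_t, map_smul, sigma_t]

theorem algEquiv_ext {h : k[X]} {ρ θ : A h ≃ₐ[k] A h} (hx : ρ (x h) = θ (x h))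
    (ht : ρ (t h) = θ (t h)) : ρ = θ := by
  have : (ρ : A h →ₐ[k] A h) = θ := hom_ext hx ht
  exact AlgEquiv.ext fun u => DFunLike.congr_fun this u

theorem sigma_zero (h : k[X]) : sigma h 0 = 1 :=
  algEquiv_ext (by simp [sigma_x]) (by simp [sigma_t, ofPoly])

/-- When the second coefficient of `h` vanishes, the automorphisms of `A_h` are the
`σ_r τ_a`. -/
theorem exists_eq_sigma_mul_tau [CharZero k] {h : k[X]} (hh : 1 ≤ h.natDegree)
    (hc : h.coeff (h.natDegree - 1) = 0) (ρ : A h ≃ₐ[k] A h) :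
    ∃ (r : k[X]) (a : scal h), ρ = sigma h r * tau h a := by
  have h0 : h ≠ 0 := by rintro rfl; simp at hh
  obtain ⟨a, b, ha, hx⟩ := apply_x_eq_linear hh ρ
  obtain ⟨c, hc0, hρ⟩ := exists_apply_ofPoly_self h0 ρ
  have e' : ρ (ofPoly h h) = aeval (ρ (x h)) h := map_ofPoly ρ.toAlgHom h
  have e : h.comp (C a * X + C b) = h * C c := by
    apply ofPoly_injective h
    rw [← aeval_ofPoly, ← hx, ← e', hρ, ofPoly_mul]
  obtain ⟨rfl, rfl⟩ := affine_comp_eq hh hc ha e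
  let a' : scal h := ⟨Units.mk0 a ha, by
    change h.comp (C a * X) = C (a ^ h.natDegree) * h
    rw [mul_comm _ h]; simpa using e⟩
  set m : k := a ^ ((h.natDegree : ℤ) - 1) with hm
  have hm0 : m ≠ 0 := zpow_ne_zero _ ha
  have hma : a * m = a ^ h.natDegree := by
    rw [hm, ← zpow_one_add₀ ha]; simp
  have hx' : ρ (x h) = a • x h := by
    rw [hx]; simp [ofPoly, Algebra.smul_def]
  -- `ρ t - a ^ (N - 1) t` commutes with `x`
  have hcomm : (ρ (t h) - m • t h) * x h = x h * (ρ (t h) - m • t h) := by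
    have e2 := congrArg ρ (t_mul_x h)
    rw [map_mul, map_add, map_mul, hρ, hx'] at e2
    have e3 : ofPoly h h * ofPoly h (C (a ^ h.natDegree)) = (a * m) • ofPoly h h := by
      rw [hma, ofPoly, ofPoly, aeval_C, ← Algebra.commutes, Algebra.smul_def]
    rw [e3, mul_smul_comm, smul_mul_assoc, mul_smul, ← smul_add] at e2
    have e4 := smul_right_injective _ ha e2
    rw [sub_mul, mul_sub, e4, smul_mul_assoc, t_mul_x, mul_smul_comm, smul_add]
    abel
  obtain ⟨p, hp⟩ := eq_ofPoly_of_commute_x h0 hcomm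
  refine ⟨C m⁻¹ * p, a', algEquiv_ext ?_ ?_⟩
  · rw [sigma_mul_tau_x, hx']; rfl
  · rw [sigma_mul_tau_t]
    change _ = m • _
    rw [smul_add, ofPoly_mul, ← hp]
    simp [ofPoly, ← Algebra.smul_def, smul_smul, hm0]

end Automorphisms

/-! ### Automorphisms commuting with `ad_W + Δ_s` -/

section Isotropy

variable {k : Type*} [Field k]

/-- If `D = ad_W + Δ_s` commutes with an automorphism rescaling `x`, that automorphism fixes
`W` up to an element of the centralizer of `x`. -/
theorem exists_apply_eq_add_ofPoly [CharZero k] {h s : k[X]} (h0 : h ≠ 0) {W : A h}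
    {ρ : A h ≃ₐ[k] A h} (hρ : ρ ∈ isotropy (ad k (A h) W + delta h s)) {a : k} (ha : a ≠ 0)
    (hx : ρ (x h) = a • x h) : ∃ g, ρ W = W + ofPoly h g := by
  have e := hρ (x h)
  simp only [LinearMap.add_apply, ad_apply, delta_x, add_zero, map_sub, map_mul, hx, map_smul,
    mul_smul_comm, smul_mul_assoc, ← smul_sub] at e
  have e := smul_right_injective _ ha e
  have hcomm : (ρ W - W) * x h = x h * (ρ W - W) := by
    rw [sub_mul, mul_sub, sub_eq_sub_iff_add_eq_add]
    rw [sub_eq_sub_iff_add_eq_add] at e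
    rw [e, add_comm]
  obtain ⟨g, hg⟩ := eq_ofPoly_of_commute_x h0 hcomm
  exact ⟨g, by rw [← hg]; abel⟩

theorem symb_t_add_mul (h r : k[X]) (u : A h) :
    symb h ((t h + ofPoly h r) * u) = tOp h (symb h u) + C r * symb h u := by
  rw [add_mul, map_add, symb_t_mul, symb_ofPoly_mul]

theorem natDegree_symb_t_add_pow_le (h r : k[X]) (n : ℕ) :
    (symb h ((t h + ofPoly h r) ^ n)).natDegree ≤ n := by
  induction n with
  | zero => simp [symb_one]
  | succ n ih =>
    rw [pow_succ', symb_t_add_mul]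
    exact natDegree_add_le_of_le (natDegree_tOp_le h ih)
      ((natDegree_C_mul_le _ _).trans (ih.trans n.le_succ)) |>.trans (by simp)

theorem coeff_symb_t_add_pow_self (h r : k[X]) (n : ℕ) :
    (symb h ((t h + ofPoly h r) ^ n)).coeff n = 1 := by
  induction n with
  | zero => simp [symb_one]
  | succ n ih =>
    have hn := natDegree_symb_t_add_pow_le h r n
    rw [pow_succ', symb_t_add_mul, coeff_add, coeff_tOp_top h hn, ih, coeff_C_mul,
      coeff_eq_zero_of_natDegree_lt (Nat.lt_succ_of_le hn), mul_zero, add_zero]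

theorem coeff_symb_t_add_pow_succ (h r : k[X]) (n : ℕ) :
    (symb h ((t h + ofPoly h r) ^ (n + 1))).coeff n = (n + 1 : k[X]) * r := by
  induction n with
  | zero => simpa [symb_ofPoly, symb_one, coeff_tOp_zero] using
      congrArg (fun p => p.coeff 0) (symb_t_add_mul h r 1)
  | succ n ih =>
    rw [pow_succ', symb_t_add_mul, coeff_add, coeff_tOp_succ, ih, coeff_C_mul,
      coeff_symb_t_add_pow_self]
    simp
    ring

theorem tau_ofPoly (h p : k[X]) (a : scal h) :
    tau h a (ofPoly h p) = ofPoly h (p.comp (C ((a : kˣ) : k) * X)) := by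
  have e : tau h a (ofPoly h p) = aeval (tau h a (x h)) p := map_ofPoly (tau h a).toAlgHom p
  rw [e, tau_x, ← aeval_ofPoly]
  simp [ofPoly, Algebra.smul_def]

theorem sigma_ofPoly (h r p : k[X]) : sigma h r (ofPoly h p) = ofPoly h p := by
  have e : sigma h r (ofPoly h p) = aeval (sigma h r (x h)) p := map_ofPoly (sigma h r).toAlgHom p
  rw [e, sigma_x, ofPoly]

theorem symb_sum (h : k[X]) (w : ℕ → k[X]) (n : ℕ) :
    symb h (∑ i ∈ Finset.range n, ofPoly h (w i) * t h ^ i) =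
      ∑ i ∈ Finset.range n, monomial i (w i) := by
  simp [symb_ofPoly_mul, symb_t_pow, C_mul_X_pow_eq_monomial]

theorem symb_sigma_mul_tau_sum (h r : k[X]) (a : scal h) (w : ℕ → k[X]) (n : ℕ) :
    symb h ((sigma h r * tau h a) (∑ i ∈ Finset.range n, ofPoly h (w i) * t h ^ i)) =
      ∑ i ∈ Finset.range n, ((((a : kˣ) : k) ^ ((h.natDegree : ℤ) - 1)) ^ i) •
        (C ((w i).comp (C ((a : kˣ) : k) * X)) * symb h ((t h + ofPoly h r) ^ i)) := by
  have e : ∀ p, (sigma h r * tau h a) (ofPoly h p) = ofPoly h (p.comp (C ((a : kˣ) : k) * X)) :=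
    fun p => by rw [AlgEquiv.mul_apply, tau_ofPoly, sigma_ofPoly]
  simp only [map_sum, map_mul, map_pow, sigma_mul_tau_t, _root_.smul_pow, mul_smul_comm, map_smul,
    e, symb_ofPoly_mul]

/-- The coefficient of `t ^ (ℓ - 1)` in `σ_r τ_a W` is a nonzero multiple of `ℓ w_ℓ(a x) r`. -/
theorem eq_zero_of_sigma_mul_tau_mem_isotropy [CharZero k] {h s : k[X]} (h0 : h ≠ 0)
    {ℓ : ℕ} (hℓ : 2 ≤ ℓ) {w : ℕ → k[X]} (hw : w ℓ ≠ 0) (hw' : w (ℓ - 1) = 0) {W : A h}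
    (hW : W = ∑ i ∈ Finset.range (ℓ + 1), ofPoly h (w i) * t h ^ i) {r : k[X]} {a : scal h}
    (hρ : sigma h r * tau h a ∈ isotropy (ad k (A h) W + delta h s)) : r = 0 := by
  obtain ⟨n, rfl⟩ : ∃ n, ℓ = n + 1 := ⟨ℓ - 1, by omega⟩
  have ha : ((a : kˣ) : k) ≠ 0 := Units.ne_zero _
  obtain ⟨g, hg⟩ := exists_apply_eq_add_ofPoly h0 hρ ha (sigma_mul_tau_x h r a)
  have e := congrArg (fun u => (symb h u).coeff n) hg
  simp only [hW, map_add] at e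
  rw [symb_sigma_mul_tau_sum, symb_sum, symb_ofPoly, Finset.sum_range_succ,
    Finset.sum_range_succ, coeff_add, coeff_add, finsetSum_coeff, Finset.sum_eq_zero] at e
  · rw [Nat.add_sub_cancel] at hw'
    simp only [coeff_smul, coeff_C_mul, coeff_symb_t_add_pow_succ, coeff_add, finsetSum_coeff,
      coeff_monomial, hw', coeff_C_of_ne_zero (show n ≠ 0 by omega)] at e
    have hn0 := Nat.cast_add_one_ne_zero (R := k[X]) n
    have hwc : (w (n + 1)).comp (C ((a : kˣ) : k) * X) ≠ 0 := by
      simpa [comp_C_mul_X_eq_zero_iff, ha] using hw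
    simpa [hw', hwc, hn0, ha, zpow_ne_zero] using e
  · intro i hi
    have := Finset.mem_range.1 hi
    rw [coeff_smul, coeff_C_mul, coeff_eq_zero_of_natDegree_lt, mul_zero, smul_zero]
    exact (natDegree_symb_t_add_pow_le h r i).trans_lt this

theorem mem_isotropy_of_generators {h : k[X]} {D : Module.End k (A h)} (hD : D ∈ Der k (A h))
    {ρ : A h ≃ₐ[k] A h} (hx : ρ (D (x h)) = D (ρ (x h))) (ht : ρ (D (t h)) = D (ρ (t h))) :
    ρ ∈ isotropy D := by
  have hD : ∀ u v : A h, D (u * v) = D u * v + u * D v := hD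
  have h1 : D 1 = 0 := by simpa using hD 1 1
  intro u
  induction u using OreAlg.induction with
  | hs c => simp [Algebra.algebraMap_eq_smul_one, h1]
  | hx => exact hx
  | ht => exact ht
  | hadd u v hu hv => simp only [map_add, hu, hv]
  | hmul u v hu hv => simp only [map_mul, map_add, hD, hu, hv]

theorem ofPoly_smul (h p : k[X]) (c : k) : ofPoly h (C c * p) = c • ofPoly h p := by
  simp [ofPoly, Algebra.smul_def]

theorem tau_mem_isotropy_iff [CharZero k] {h s : k[X]} (hh : 1 ≤ h.natDegree)
    (hs : s.degree < h.degree) {n : ℕ} {w : ℕ → k[X]} {W : A h}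
    (hW : W = ∑ i ∈ Finset.range (n + 1), ofPoly h (w i) * t h ^ i) {a : scal h} :
    tau h a ∈ isotropy (ad k (A h) W + delta h s) ↔ tau h a W = W ∧
      s.comp (C ((a : kˣ) : k) * X) = C (((a : kˣ) : k) ^ (h.natDegree - 1)) * s := by
  have h0 : h ≠ 0 := by rintro rfl; simp at hh
  have ha : ((a : kˣ) : k) ≠ 0 := Units.ne_zero _
  have hexp : ((a : kˣ) : k) ^ ((h.natDegree : ℤ) - 1) = ((a : kˣ) : k) ^ (h.natDegree - 1) := by
    rw [← zpow_natCast, Nat.cast_sub hh, Nat.cast_one]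
  have ht := tau_t h a
  rw [hexp] at ht
  set m := ((a : kˣ) : k) ^ (h.natDegree - 1)
  have hm : m ≠ 0 := pow_ne_zero _ ha
  constructor
  · intro hρ
    obtain ⟨g, hg⟩ := exists_apply_eq_add_ofPoly h0 hρ ha (tau_x h a)
    -- commutation at `t` reads `s(a x) - a ^ (N - 1) s = a ^ (N - 1) h g'`
    have e := hρ (t h)
    simp only [LinearMap.add_apply, ad_apply, delta_t, map_add, map_sub, map_mul, ht, map_smul,
      hg, tau_ofPoly] at e
    have e1 : ofPoly h (s.comp (C ((a : kˣ) : k) * X)) =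
        ofPoly h (C m * s + h * (C m * derivative g)) := by
      have := t_mul_ofPoly h g
      have e2 : ofPoly h (C m * s + h * (C m * derivative g)) =
          m • ofPoly h s + m • ofPoly h (h * derivative g) := by
        rw [← ofPoly_smul, ← ofPoly_smul]
        simp only [ofPoly, ← map_add]
        congr 1; ring
      rw [e2]
      rw [add_mul, mul_add] at e
      simp only [mul_smul_comm, smul_mul_assoc, this, smul_add, smul_sub] at e
      rw [← sub_eq_zero] at e ⊢
      rw [← e]
      abel
    have e2 := ofPoly_injective h e1
    have hg0 : derivative g = 0 := by
      by_contra hne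
      have hlt : (h * (C m * derivative g)).degree < h.degree := by
        have : h * (C m * derivative g) = s.comp (C ((a : kˣ) : k) * X) - C m * s := by
          rw [e2]; ring
        rw [this]
        refine (degree_sub_le _ _).trans_lt (max_lt ?_ ?_)
        · refine lt_of_le_of_lt ((degree_le_iff_coeff_zero _ _).2 fun i hi => ?_) hs
          rw [comp_C_mul_X_coeff, coeff_eq_zero_of_degree_lt hi, zero_mul]
        · rwa [degree_C_mul hm]
      have := degree_le_mul_left h (mul_ne_zero (C_ne_zero.2 hm) hne)
      exact absurd hlt (not_lt.2 this)
    refine ⟨?_, by rw [e2, hg0]; ring⟩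
    -- `τ_a W - W` is a scalar, seen to vanish at `t = 0`, `x = 0`
    have hgC := derivative_eq_zero.1 hg0
    have hone : tau h a = sigma h 0 * tau h a := by rw [sigma_zero, one_mul]
    have e3 := congrArg (fun u => (symb h u).coeff 0) hg
    simp only [map_add, symb_ofPoly] at e3
    rw [hone, hW, symb_sigma_mul_tau_sum, symb_sum] at e3
    have hz : ofPoly h 0 = 0 := by simp [ofPoly]
    simp only [hz, add_zero, symb_t_pow, finsetSum_coeff, coeff_add, coeff_smul, coeff_C_mul,
      coeff_monomial, coeff_C_zero, coeff_X_pow] at e3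
    have e4 := congrArg (eval 0) e3
    have : g = 0 := by
      rw [eq_C_of_natDegree_eq_zero hgC] at e4 ⊢
      simp at e4
      simp [e4]
    rw [hg, this, hz, add_zero]
  · rintro ⟨h1, h2⟩
    refine mem_isotropy_of_generators
      (Submodule.add_mem _ (ad_mem_der k _ W) (delta_mem_der h s)) ?_ ?_
    · simp [LinearMap.add_apply, ad_apply, delta_x, tau_x, h1, smul_sub]
    · simp [LinearMap.add_apply, ad_apply, delta_t, ht, h1, tau_ofPoly, h2, ofPoly_smul, smul_sub]

end Isotropy

end OreAlg

theorem mainTheorem7 {k : Type*} [Field k] [IsAlgClosed k] [CharZero k]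
    (h : k[X]) (hh : 1 ≤ h.natDegree)
    (ℓ : ℕ) (hℓ : 2 ≤ ℓ) (w : ℕ → k[X]) (hw : w ℓ ≠ 0) (hw' : w (ℓ - 1) = 0)
    (s : k[X]) (hs : s.degree < h.degree)
    (W : OreAlg.A h)
    (hW : W = ∑ i ∈ Finset.range (ℓ + 1), OreAlg.ofPoly h (w i) * OreAlg.t h ^ i)
    (D : Module.End k (OreAlg.A h))
    (hD : D = OreAlg.ad k (OreAlg.A h) W + OreAlg.delta h s) :
    (∀ (r : k[X]) (a : OreAlg.scal h),
      OreAlg.sigma h r * OreAlg.tau h a ∈ OreAlg.isotropy D → r = 0) ∧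
    (h.coeff (h.natDegree - 1) = 0 →
      (OreAlg.isotropy D : Set (OreAlg.A h ≃ₐ[k] OreAlg.A h)) =
        {ρ | ∃ a : OreAlg.scal h, ρ = OreAlg.tau h a ∧ OreAlg.tau h a W = W ∧
          s.comp (C ((a : kˣ) : k) * X) = C (((a : kˣ) : k) ^ (h.natDegree - 1)) * s} ∧
      (∀ c : k, s = C c * X ^ (h.natDegree - 1) →
        (OreAlg.isotropy D : Set (OreAlg.A h ≃ₐ[k] OreAlg.A h)) =
          {ρ | ∃ a : OreAlg.scal h, ρ = OreAlg.tau h a ∧ OreAlg.tau h a W = W})) := by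
  subst hD
  have h0 : h ≠ 0 := by rintro rfl; simp at hh
  have part1 : ∀ (r : k[X]) (a : OreAlg.scal h),
      OreAlg.sigma h r * OreAlg.tau h a ∈
        OreAlg.isotropy (OreAlg.ad k (OreAlg.A h) W + OreAlg.delta h s) → r = 0 :=
    fun r a hρ => OreAlg.eq_zero_of_sigma_mul_tau_mem_isotropy h0 hℓ hw hw' hW hρ
  refine ⟨part1, fun hc => ?_⟩
  have part2 : (OreAlg.isotropy (OreAlg.ad k (OreAlg.A h) W + OreAlg.delta h s) :
      Set (OreAlg.A h ≃ₐ[k] OreAlg.A h)) =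
        {ρ | ∃ a : OreAlg.scal h, ρ = OreAlg.tau h a ∧ OreAlg.tau h a W = W ∧
          s.comp (C ((a : kˣ) : k) * X) = C (((a : kˣ) : k) ^ (h.natDegree - 1)) * s} := by
    ext ρ
    constructor
    · intro hρ
      obtain ⟨r, a, rfl⟩ := OreAlg.exists_eq_sigma_mul_tau hh hc ρ
      obtain rfl := part1 r a hρ
      rw [OreAlg.sigma_zero, one_mul] at hρ ⊢
      exact ⟨a, rfl, (OreAlg.tau_mem_isotropy_iff hh hs hW).1 hρ⟩
    · rintro ⟨a, rfl, ha⟩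
      exact (OreAlg.tau_mem_isotropy_iff hh hs hW).2 ha
  refine ⟨part2, fun c hsc => part2.trans ?_⟩
  ext ρ
  refine exists_congr fun a => and_congr_right fun _ => and_iff_left ?_
  rw [hsc]
  simp [mul_pow]
  ring
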